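/- Let $\Bbbk$ be an algebraically closed field. A finite $\Bbbk$-linear category is a $\Bbbk$-linear abelian category that is $\Bbbk$-linearly equivalent to the category of finite-dimensional modules over a finite-dimensional $\Bbbk$-algebra. Let $\mathcal C$ be a finite tensor category over $\Bbbk$, i.e. a finite $\Bbbk$-linear category with a rigid monoidal structure whose tensor product is $\Bbbk$-bilinear and whose monoidal unit is simple, and let $\mathcal M$ be a finite (left) $\mathcal C$-module category, i.e. a $\mathcal C$-module category that is a finite $\Bbbk$-linear category and whose action functor $\mathcal C\times\mathcal M\to\mathcal M$ is $\Bbbk$-linear and right exact in both variables. Let $\mathcal{R}ex_{\mathcal C}(\mathcal M,\mathcal M)$ be the category of right exact $\mathcal C$-module endofunctors of $\mathcal M$ and module natural transformations. It is a module category over the Drinfeld center $\mathcal Z(\mathcal C)$: for $z=(c_0,\beta_0)\in\mathcal Z(\mathcal C)$ and $F\in\mathcal{R}ex_{\mathcal C}(\mathcal M,\mathcal M)$, the functor $z.F$ is $m\mapsto c_0.F(m)$ with the module functor structure $$c_0.F(c.m)\cong c_0.(c.F(m))\cong(c_0\otimes c).F(m)\xrightarrow{(\beta_0)_c.F(m)}(c\otimes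 c_0).F(m)\cong c.(c_0.F(m)).$$ The object of internal natural transformations $\underline{\mathrm{Nat}}(\mathrm{Id}_{\mathcal M},\mathrm{Id}_{\mathcal M})\in\mathcal Z(\mathcal C)$ is the internal Hom from $\mathrm{Id}_{\mathcal M}$ to $\mathrm{Id}_{\mathcal M}$ of this module category, i.e. an object with isomorphisms $$\mathrm{Hom}_{\mathcal Z(\mathcal C)}\big(z,\underline{\mathrm{Nat}}(\mathrm{Id}_{\mathcal M},\mathrm{Id}_{\mathcal M})\big)\cong\mathrm{Hom}_{\mathcal{R}ex_{\mathcal C}(\mathcal M,\mathcal M)}(z.\mathrm{Id}_{\mathcal M},\mathrm{Id}_{\mathcal M})$$ natural in $z\in\mathcal Z(\mathcal C)$. As an internal End it carries an algebra structure in $\mathcal Z(\mathcal C)$: with $N:=\underline{\mathrm{Nat}}(\mathrm{Id}_{\mathcal M},\mathrm{Id}_{\mathcal M})$ and $\underline{\mathrm{ev}}\colon N.\mathrm{Id}_{\mathcal M}\to\mathrm{Id}_{\mathcal M}$ the morphism corresponding to $\mathrm{id}_N$, the multiplication $\mu\colon N\otimes N\to N$ corresponds to $(N\otimes N).\mathrm{Id}_{\mathcal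 M}\cong N.(N.\mathrm{Id}_{\mathcal M})\xrightarrow{N.\underline{\mathrm{ev}}}N.\mathrm{Id}_{\mathcal M}\xrightarrow{\underline{\mathrm{ev}}}\mathrm{Id}_{\mathcal M}$, and the unit corresponds to $\mathbf 1.\mathrm{Id}_{\mathcal M}\cong\mathrm{Id}_{\mathcal M}$. Then the object $\underline{\mathrm{Nat}}(\mathrm{Id}_{\mathcal M},\mathrm{Id}_{\mathcal M})$ exists, and the algebra $\underline{\mathrm{Nat}}(\mathrm{Id}_{\mathcal M},\mathrm{Id}_{\mathcal M})$ in the braided category $\mathcal Z(\mathcal C)$ is braided commutative: $\mu\circ c_{N,N}=\mu$, where $c$ is the braiding of $\mathcal Z(\mathcal C)$. -/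

import Mathlib

open CategoryTheory MonoidalCategory Limits
open scoped MonoidalLeftAction

universe w v u v₁ u₁ v₂ u₂

/-! ### Internal Homs of a module category -/

section InternalHom

variable (Z : Type u) [Category.{v} Z] [MonoidalCategory Z]
  {R : Type u₁} [Category.{v₁} R] [MonoidalLeftAction Z R]

/-- An internal Hom from `m` to `m'` in `Z`, for objects `m`, `m'` of a `Z`-module category `R`:
an object `obj` of `Z` with bijections `Hom(z, obj) ≃ Hom(z . m, m')` natural in `z`. -/
structure InternalHom (m m' : R) where
  obj : Z
  homEquiv (z : Z) : (z ⟶ obj) ≃ (z ⊙ₗ m ⟶ m')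
  homEquiv_comp {z z' : Z} (f : z ⟶ z') (g : z' ⟶ obj) :
    homEquiv z (f ≫ g) = f ⊵ₗ m ≫ homEquiv z' g

namespace InternalHom

variable {Z} {m m' m'' : R}

/-- The evaluation `Hom(m, m') . m ⟶ m'`. -/
def ev (H : InternalHom Z m m') : H.obj ⊙ₗ m ⟶ m' := H.homEquiv H.obj (𝟙 H.obj)

theorem homEquiv_eq (H : InternalHom Z m m') {z : Z} (f : z ⟶ H.obj) :
    H.homEquiv z f = f ⊵ₗ m ≫ H.ev := by
  rw [ev, ← H.homEquiv_comp, Category.comp_id]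

theorem hom_ext (H : InternalHom Z m m') {z : Z} {f g : z ⟶ H.obj}
    (h : f ⊵ₗ m ≫ H.ev = g ⊵ₗ m ≫ H.ev) : f = g :=
  (H.homEquiv z).injective (by rw [homEquiv_eq, homEquiv_eq, h])

/-- The multiplication `Hom(m', m'') ⊗ Hom(m, m') ⟶ Hom(m, m'')` of internal Homs: the morphism
that corresponds to `(Hom(m', m'') ⊗ Hom(m, m')) . m ≅ Hom(m', m'') . (Hom(m, m') . m) ⟶
Hom(m', m'') . m' ⟶ m''`. -/
def mult (H₂ : InternalHom Z m' m'') (H₁ : InternalHom Z m m') (H : InternalHom Z m m'') :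
    H₂.obj ⊗ H₁.obj ⟶ H.obj :=
  (H.homEquiv _).symm ((αₗ H₂.obj H₁.obj m).hom ≫ H₂.obj ⊴ₗ H₁.ev ≫ H₂.ev)

/-- The unit `𝟙 ⟶ Hom(m, m)`: the morphism that corresponds to `𝟙 . m ≅ m`. -/
def unit (H : InternalHom Z m m) : 𝟙_ Z ⟶ H.obj :=
  (H.homEquiv _).symm (λₗ m).hom

theorem mult_ev (H₂ : InternalHom Z m' m'') (H₁ : InternalHom Z m m') (H : InternalHom Z m m'') :
    mult H₂ H₁ H ⊵ₗ m ≫ H.ev = (αₗ H₂.obj H₁.obj m).hom ≫ H₂.obj ⊴ₗ H₁.ev ≫ H₂.ev := by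
  rw [← homEquiv_eq, mult, Equiv.apply_symm_apply]

theorem unit_ev (H : InternalHom Z m m) : H.unit ⊵ₗ m ≫ H.ev = (λₗ m).hom := by
  rw [← homEquiv_eq, unit, Equiv.apply_symm_apply]

/-- The algebra structure on the internal End `Hom(m, m)`. -/
abbrev algebra (H : InternalHom Z m m) : MonObj H.obj where
  one := H.unit
  mul := mult H H H
  one_mul := H.hom_ext <| by
    rw [MonoidalLeftAction.comp_actionHomLeft, Category.assoc, mult_ev,
      MonoidalLeftAction.whiskerRight_actionHomLeft]
    simp only [Category.assoc, Iso.inv_hom_id_assoc]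
    rw [← MonoidalLeftAction.action_exchange_assoc, unit_ev]
    simp
  mul_one := H.hom_ext <| by
    rw [MonoidalLeftAction.comp_actionHomLeft, Category.assoc, mult_ev,
      MonoidalLeftAction.whiskerLeft_actionHomLeft]
    simp only [Category.assoc, Iso.inv_hom_id_assoc]
    rw [← MonoidalLeftAction.actionHomRight_comp_assoc, unit_ev]
    simp
  mul_assoc := H.hom_ext <| by
    simp only [MonoidalLeftAction.comp_actionHomLeft, Category.assoc, mult_ev,
      MonoidalLeftAction.whiskerLeft_actionHomLeft, MonoidalLeftAction.whiskerRight_actionHomLeft,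
      Iso.inv_hom_id_assoc]
    rw [← MonoidalLeftAction.action_exchange_assoc, mult_ev,
      ← MonoidalLeftAction.actionHomRight_comp_assoc H.obj, mult_ev]
    simp

end InternalHom

end InternalHom

/-! ### Finite tensor categories and their finite module categories -/

section Finite

variable (k : Type w) [Field k]

open scoped ModuleCat.Algebra in
/-- A finite `k`-linear category: a `k`-linear abelian category that is `k`-linearly equivalent to
the category of finite-dimensional modules over a finite-dimensional `k`-algebra. -/
class FiniteLinearCategory (X : Type u) [Category.{v} X] [Abelian X] [Linear k X] : Prop where
  exists_equivalence : ∃ (A : Type w) (_ : Ring A) (_ : Algebra k A) (_ : Module.Finite k A)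
    (e : X ≌ FGModuleCat.{w} A), e.functor.Additive ∧ e.functor.Linear k

/-- A finite tensor category over `k`: a finite `k`-linear category with a rigid monoidal structure
whose tensor product is `k`-bilinear and whose monoidal unit is simple. -/
class FiniteTensorCategory (C : Type u) [Category.{v} C] [Abelian C] [Linear k C]
    [MonoidalCategory C] : Prop extends
    FiniteLinearCategory k C, MonoidalPreadditive C, MonoidalLinear k C where
  rigid : Nonempty (RigidCategory C)
  simple_unit : Simple (𝟙_ C)

/-- The action of `C` on `M` is right exact in both variables. -/
class RightExactAction (C : Type u) [Category.{v} C] [MonoidalCategory C]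
    (M : Type u₁) [Category.{v₁} M] [MonoidalLeftAction C M] : Prop where
  actionRight (m : M) : PreservesFiniteColimits (MonoidalLeftAction.actionRight C m)
  actionLeft (c : C) : PreservesFiniteColimits (MonoidalLeftAction.actionLeft M c)

/-- A finite module category over `C`: a `C`-module category `M` that is a finite `k`-linear
category and on which `C` acts by a functor that is `k`-linear and right exact in both variables. -/
class FiniteModuleCategory (C : Type u) [Category.{v} C] [Abelian C] [Linear k C]
    [MonoidalCategory C] (M : Type u₁) [Category.{v₁} M] [Abelian M] [Linear k M]
    [MonoidalLeftAction C M] : Prop extends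
    FiniteLinearCategory k M, RightExactAction C M where
  add_actionHomLeft {c c' : C} (f g : c ⟶ c') (m : M) : (f + g) ⊵ₗ m = f ⊵ₗ m + g ⊵ₗ m
  smul_actionHomLeft {c c' : C} (r : k) (f : c ⟶ c') (m : M) : (r • f) ⊵ₗ m = r • (f ⊵ₗ m)
  actionHomRight_add (c : C) {m m' : M} (f g : m ⟶ m') : c ⊴ₗ (f + g) = c ⊴ₗ f + c ⊴ₗ g
  actionHomRight_smul (c : C) {m m' : M} (r : k) (f : m ⟶ m') : c ⊴ₗ (r • f) = r • (c ⊴ₗ f)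

end Finite

/-! ### The action of the Drinfeld center by module functors -/

section Swap

open MonoidalLeftAction

variable {C : Type u} [Category.{v} C] [MonoidalCategory C]
  {N : Type u₂} [Category.{v₂} N] [MonoidalLeftAction C N]

/-- The isomorphism `z . (c . n) ≅ (z ⊗ c) . n ≅ (c ⊗ z) . n ≅ c . (z . n)` given by a half-braiding
on `z`. -/
def HalfBraiding.swapIso {z : C} (b : HalfBraiding z) (c : C) (n : N) :
    z ⊙ₗ c ⊙ₗ n ≅ c ⊙ₗ z ⊙ₗ n where
  hom := (αₗ z c n).inv ≫ (b.β c).hom ⊵ₗ n ≫ (αₗ c z n).hom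
  inv := (αₗ c z n).inv ≫ (b.β c).inv ⊵ₗ n ≫ (αₗ z c n).hom

namespace HalfBraiding

theorem swapIso_hom {z : C} (b : HalfBraiding z) (c : C) (n : N) :
    (swapIso b c n).hom = (αₗ z c n).inv ≫ (b.β c).hom ⊵ₗ n ≫ (αₗ c z n).hom := rfl

theorem swapIso_naturality_left {z : C} (b : HalfBraiding z) {c c' : C} (f : c ⟶ c') (n : N) :
    z ⊴ₗ f ⊵ₗ n ≫ (swapIso b c' n).hom = (swapIso b c n).hom ≫ f ⊵ₗ (z ⊙ₗ n) := by
  have h := congrArg (fun t => t ⊵ₗ n) (b.naturality f)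
  simp only [comp_actionHomLeft, whiskerLeft_actionHomLeft, whiskerRight_actionHomLeft,
    Category.assoc] at h
  rw [swapIso_hom, swapIso_hom, ← cancel_epi (αₗ z c n).hom, ← cancel_mono (αₗ c' z n).inv]
  simpa only [Category.assoc, Iso.hom_inv_id, Category.comp_id, Iso.hom_inv_id_assoc] using h

theorem swapIso_naturality_right {z : C} (b : HalfBraiding z) (c : C) {n n' : N} (g : n ⟶ n') :
    z ⊴ₗ c ⊴ₗ g ≫ (swapIso b c n').hom = (swapIso b c n).hom ≫ c ⊴ₗ z ⊴ₗ g := by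
  have h := action_exchange (b.β c).hom g
  simp only [tensor_actionHomRight, Category.assoc] at h
  rw [swapIso_hom, swapIso_hom, ← cancel_epi (αₗ z c n).hom, ← cancel_mono (αₗ c z n').inv]
  simpa only [Category.assoc, Iso.hom_inv_id, Category.comp_id, Iso.hom_inv_id_assoc] using h

theorem swapIso_associativity {z : C} (b : HalfBraiding z) (c c' : C) (n : N) :
    (swapIso b (c ⊗ c') n).hom ≫ (αₗ c c' (z ⊙ₗ n)).hom =
      z ⊴ₗ (αₗ c c' n).hom ≫ (swapIso b c (c' ⊙ₗ n)).hom ≫ c ⊴ₗ (swapIso b c' n).hom := by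
  have h₁ : (αₗ z (c ⊗ c') n).inv ≫ (α_ z c c').inv ⊵ₗ n =
      z ⊴ₗ (αₗ c c' n).hom ≫ (αₗ z c (c' ⊙ₗ n)).inv ≫ (αₗ (z ⊗ c) c' n).inv := by
    rw [Iso.inv_comp_eq, ← cancel_epi ((α_ z c c').hom ⊵ₗ n)]
    simp [associator_actionHom_assoc]
  have h₂ : (α_ c z c').hom ⊵ₗ n ≫ (αₗ c (z ⊗ c') n).hom =
      (αₗ (c ⊗ z) c' n).hom ≫ (αₗ c z (c' ⊙ₗ n)).hom ≫ c ⊴ₗ (αₗ z c' n).inv := by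
    rw [← associator_actionHom_assoc]
    simp
  have h₃ : (αₗ c (c' ⊗ z) n).inv ≫ (α_ c c' z).inv ⊵ₗ n ≫ (αₗ (c ⊗ c') z n).hom ≫
      (αₗ c c' (z ⊙ₗ n)).hom = c ⊴ₗ (αₗ c' z n).hom := by
    rw [← associator_actionHom, ← comp_actionHomLeft_assoc, Iso.inv_hom_id, id_actionHomLeft,
      Category.id_comp, Iso.inv_hom_id_assoc]
  simp only [swapIso_hom, HalfBraiding.monoidal, comp_actionHomLeft, whiskerLeft_actionHomLeft,
    Category.assoc, h₃]
  rw [reassoc_of% h₁, reassoc_of% h₂]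
  simp

theorem unit_β {z : C} (b : HalfBraiding z) :
    (b.β (𝟙_ C)).hom = (ρ_ z).hom ≫ (λ_ z).inv := by
  have h := b.naturality (λ_ (𝟙_ C)).hom
  rw [b.monoidal] at h
  have h' : (b.β (𝟙_ C)).hom =
      (b.β (𝟙_ C)).hom ≫ ((λ_ z).hom ≫ (ρ_ z).inv) ≫ (b.β (𝟙_ C)).hom := by
    rw [← cancel_epi (z ◁ (λ_ (𝟙_ C)).hom)]
    exact h.trans (by monoidal)
  rw [← cancel_epi ((b.β (𝟙_ C)).hom ≫ (λ_ z).hom ≫ (ρ_ z).inv), Category.assoc, ← h']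
  simp

theorem swapIso_unitality {z : C} (b : HalfBraiding z) (n : N) :
    z ⊴ₗ (λₗ n).inv ≫ (swapIso b (𝟙_ C) n).hom = (λₗ (z ⊙ₗ n)).inv := by
  simp only [swapIso_hom, unit_β, comp_actionHomLeft, rightUnitor_actionHom, Category.assoc,
    Iso.inv_hom_id_assoc, ← actionHomRight_comp_assoc, Iso.inv_hom_id, actionHomRight_id,
    Category.id_comp]
  rw [← cancel_mono (λₗ (z ⊙ₗ n)).hom, Category.assoc, ← leftUnitor_actionHom,
    ← comp_actionHomLeft, Iso.inv_hom_id, Iso.inv_hom_id, id_actionHomLeft]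

theorem swapIso_hom_comm {z z' : Center C} (f : z ⟶ z') (c : C) (n : N) :
    f.f ⊵ₗ (c ⊙ₗ n) ≫ (swapIso z'.2 c n).hom = (swapIso z.2 c n).hom ≫ c ⊴ₗ f.f ⊵ₗ n := by
  have h := congrArg (fun t => t ⊵ₗ n) (f.comm c)
  simp only [comp_actionHomLeft, whiskerLeft_actionHomLeft, whiskerRight_actionHomLeft,
    Category.assoc] at h
  rw [swapIso_hom, swapIso_hom, ← cancel_epi (αₗ z.1 c n).hom, ← cancel_mono (αₗ c z'.1 n).inv]
  simpa only [Category.assoc, Iso.hom_inv_id, Category.comp_id, Iso.hom_inv_id_assoc] using h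

theorem swapIso_tensor (z z' : Center C) (c : C) (n : N) :
    (swapIso (z ⊗ z').2 c n).hom ≫ c ⊴ₗ (αₗ z.1 z'.1 n).hom =
      (αₗ z.1 z'.1 (c ⊙ₗ n)).hom ≫ z.1 ⊴ₗ (swapIso z'.2 c n).hom ≫
        (swapIso z.2 c (z'.1 ⊙ₗ n)).hom := by
  obtain ⟨z, b⟩ := z
  obtain ⟨z', b'⟩ := z'
  change ((αₗ (z ⊗ z') c n).inv ≫ ((α_ z z' c).hom ≫ z ◁ (b'.β c).hom ≫ (α_ z c z').inv ≫
    (b.β c).hom ▷ z' ≫ (α_ c z z').hom) ⊵ₗ n ≫ (αₗ c (z ⊗ z') n).hom) ≫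
      c ⊴ₗ (αₗ z z' n).hom = (αₗ z z' (c ⊙ₗ n)).hom ≫ z ⊴ₗ (swapIso b' c n).hom ≫
        (swapIso b c (z' ⊙ₗ n)).hom
  have h₁ : (αₗ (z ⊗ z') c n).inv ≫ (α_ z z' c).hom ⊵ₗ n =
      (αₗ z z' (c ⊙ₗ n)).hom ≫ z ⊴ₗ (αₗ z' c n).inv ≫ (αₗ z (z' ⊗ c) n).inv := by
    rw [Iso.inv_comp_eq, ← associator_actionHom_assoc]
    simp
  have h₂ : (αₗ z (c ⊗ z') n).inv ≫ (α_ z c z').inv ⊵ₗ n =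
      z ⊴ₗ (αₗ c z' n).hom ≫ (αₗ z c (z' ⊙ₗ n)).inv ≫ (αₗ (z ⊗ c) z' n).inv := by
    rw [Iso.inv_comp_eq, ← cancel_epi ((α_ z c z').hom ⊵ₗ n)]
    simp [associator_actionHom_assoc]
  simp only [swapIso_hom, comp_actionHomLeft, whiskerLeft_actionHomLeft, Category.assoc,
    associator_actionHom]
  rw [reassoc_of% h₁, reassoc_of% h₂]
  simp

theorem swapIso_tensorUnit (c : C) (n : N) :
    (swapIso (𝟙_ (Center C)).2 c n).hom ≫ c ⊴ₗ (λₗ n).hom = (λₗ (c ⊙ₗ n)).hom := by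
  change ((αₗ (𝟙_ C) c n).inv ≫ ((λ_ c).hom ≫ (ρ_ c).inv) ⊵ₗ n ≫ (αₗ c (𝟙_ C) n).hom) ≫
    c ⊴ₗ (λₗ n).hom = (λₗ (c ⊙ₗ n)).hom
  simp only [comp_actionHomLeft, Category.assoc, ← rightUnitor_actionHom, leftUnitor_actionHom,
    Iso.inv_hom_id_assoc]
  rw [← comp_actionHomLeft, Iso.inv_hom_id, id_actionHomLeft, Category.comp_id]

end HalfBraiding

end Swap

/-! ### The category of right exact module functors -/

section Rex

/-- A right exact `C`-module functor from `M` to `N`. -/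
structure RexModuleFunctor (C : Type u) [Category.{v} C] [MonoidalCategory C]
    (M : Type u₁) [Category.{v₁} M] [MonoidalLeftAction C M]
    (N : Type u₂) [Category.{v₂} N] [MonoidalLeftAction C N] where
  functor : M ⥤ N
  [moduleFunctor : functor.LeftLinear C]
  [rightExact : PreservesFiniteColimits functor]

namespace RexModuleFunctor

open Functor.LaxLeftLinear Functor.OplaxLeftLinear

attribute [instance] moduleFunctor rightExact

variable {C : Type u} [Category.{v} C] [MonoidalCategory C]
  {M : Type u₁} [Category.{v₁} M] [MonoidalLeftAction C M]
  {N : Type u₂} [Category.{v₂} N] [MonoidalLeftAction C N]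

/-- The constraint `F (c . m) ⟶ c . F m` of a module functor. -/
abbrev φ (F : RexModuleFunctor C M N) (c : C) (m : M) :
    F.functor.obj (c ⊙ₗ m) ⟶ c ⊙ₗ F.functor.obj m :=
  δₗ F.functor c m

/-- A module natural transformation. -/
@[ext]
structure Hom (F G : RexModuleFunctor C M N) where
  natTrans : F.functor ⟶ G.functor
  comm (c : C) (m : M) : natTrans.app (c ⊙ₗ m) ≫ G.φ c m = F.φ c m ≫ c ⊴ₗ natTrans.app m

instance : Category (RexModuleFunctor C M N) where
  Hom := Hom
  id F := { natTrans := 𝟙 F.functor, comm := by simp }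
  comp α β := { natTrans := α.natTrans ≫ β.natTrans
                comm := fun c m => by
                  simp only [NatTrans.comp_app, Category.assoc, β.comm,
                    MonoidalLeftAction.actionHomRight_comp]
                  rw [← Category.assoc, α.comm, Category.assoc] }

@[simp]
theorem id_natTrans (F : RexModuleFunctor C M N) : Hom.natTrans (𝟙 F) = 𝟙 F.functor := rfl

@[simp]
theorem comp_natTrans {F G H : RexModuleFunctor C M N} (α : F ⟶ G) (β : G ⟶ H) :
    (α ≫ β).natTrans = α.natTrans ≫ β.natTrans := rfl

@[ext]
theorem hom_ext {F G : RexModuleFunctor C M N} {α β : F ⟶ G}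
    (h : ∀ m, α.natTrans.app m = β.natTrans.app m) : α = β :=
  Hom.ext (NatTrans.ext (funext h))

variable (C M) in
/-- The identity functor of `M`, as a module functor. -/
def identity : RexModuleFunctor C M M where
  functor := 𝟭 M
  moduleFunctor :=
    { μₗ := fun c m => 𝟙 (c ⊙ₗ m)
      δₗ := fun c m => 𝟙 (c ⊙ₗ m)
      μₗ_comp_δₗ := by simp
      δₗ_comp_μₗ := by simp }

section Action

open HalfBraiding

/-- The constraint of the module functor `z . F = z . F(-)`, for `z` an object with a half-braiding
`b`: `z . F (c . m) ≅ z . (c . F m) ≅ (z ⊗ c) . F m ≅ (c ⊗ z) . F m ≅ c . (z . F m)`, where the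
third isomorphism is the half-braiding. -/
def smulIso {z : C} (b : HalfBraiding z) (F : RexModuleFunctor C M N) (c : C) (m : M) :
    z ⊙ₗ F.functor.obj (c ⊙ₗ m) ≅ c ⊙ₗ (z ⊙ₗ F.functor.obj m) :=
  (MonoidalLeftAction.actionLeft N z).mapIso (Functor.LeftLinear.μₗIso F.functor c m).symm ≪≫
    swapIso b c (F.functor.obj m)

theorem smulIso_hom {z : C} (b : HalfBraiding z) (F : RexModuleFunctor C M N) (c : C) (m : M) :
    (smulIso b F c m).hom = z ⊴ₗ F.φ c m ≫ (swapIso b c (F.functor.obj m)).hom := rfl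

theorem smulIso_naturality_left {z : C} (b : HalfBraiding z) (F : RexModuleFunctor C M N) {c c' : C}
    (f : c ⟶ c') (m : M) :
    z ⊴ₗ F.functor.map (f ⊵ₗ m) ≫ (smulIso b F c' m).hom =
      (smulIso b F c m).hom ≫ f ⊵ₗ (z ⊙ₗ F.functor.obj m) := by
  rw [smulIso_hom, smulIso_hom, ← MonoidalLeftAction.actionHomRight_comp_assoc,
    δₗ_naturality_left, MonoidalLeftAction.actionHomRight_comp_assoc, swapIso_naturality_left,
    Category.assoc]

theorem smulIso_naturality_right {z : C} (b : HalfBraiding z) (F : RexModuleFunctor C M N) (c : C)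
    {m m' : M} (f : m ⟶ m') :
    z ⊴ₗ F.functor.map (c ⊴ₗ f) ≫ (smulIso b F c m').hom =
      (smulIso b F c m).hom ≫ c ⊴ₗ (z ⊴ₗ F.functor.map f) := by
  rw [smulIso_hom, smulIso_hom, ← MonoidalLeftAction.actionHomRight_comp_assoc,
    δₗ_naturality_right, MonoidalLeftAction.actionHomRight_comp_assoc, swapIso_naturality_right,
    Category.assoc]

theorem smulIso_associativity {z : C} (b : HalfBraiding z) (F : RexModuleFunctor C M N) (c c' : C)
    (m : M) :
    (smulIso b F (c ⊗ c') m).hom ≫ (αₗ c c' (z ⊙ₗ F.functor.obj m)).hom =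
      z ⊴ₗ F.functor.map (αₗ c c' m).hom ≫ (smulIso b F c (c' ⊙ₗ m)).hom ≫
        c ⊴ₗ (smulIso b F c' m).hom := by
  simp only [smulIso_hom, Category.assoc, swapIso_associativity,
    MonoidalLeftAction.actionHomRight_comp]
  rw [← reassoc_of% (swapIso_naturality_right b), ← MonoidalLeftAction.actionHomRight_comp_assoc,
    δₗ_associativity]
  simp only [MonoidalLeftAction.actionHomRight_comp, Category.assoc]

theorem smulIso_unitality {z : C} (b : HalfBraiding z) (F : RexModuleFunctor C M N) (m : M) :
    (λₗ (z ⊙ₗ F.functor.obj m)).inv =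
      z ⊴ₗ F.functor.map (λₗ m).inv ≫ (smulIso b F (𝟙_ C) m).hom := by
  rw [smulIso_hom, ← MonoidalLeftAction.actionHomRight_comp_assoc, ← δₗ_unitality_inv,
    swapIso_unitality]

theorem smulIso_inv_naturality_left {z : C} (b : HalfBraiding z) (F : RexModuleFunctor C M N)
    {c c' : C} (f : c ⟶ c') (m : M) :
    f ⊵ₗ (z ⊙ₗ F.functor.obj m) ≫ (smulIso b F c' m).inv =
      (smulIso b F c m).inv ≫ z ⊴ₗ F.functor.map (f ⊵ₗ m) := by
  rw [Iso.comp_inv_eq, Category.assoc, smulIso_naturality_left, Iso.inv_hom_id_assoc]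

theorem smulIso_inv_naturality_right {z : C} (b : HalfBraiding z) (F : RexModuleFunctor C M N)
    (c : C) {m m' : M} (f : m ⟶ m') :
    c ⊴ₗ (z ⊴ₗ F.functor.map f) ≫ (smulIso b F c m').inv =
      (smulIso b F c m).inv ≫ z ⊴ₗ F.functor.map (c ⊴ₗ f) := by
  rw [Iso.comp_inv_eq, Category.assoc, smulIso_naturality_right, Iso.inv_hom_id_assoc]

theorem smulIso_inv_associativity {z : C} (b : HalfBraiding z) (F : RexModuleFunctor C M N)
    (c c' : C) (m : M) :
    (smulIso b F (c ⊗ c') m).inv ≫ z ⊴ₗ F.functor.map (αₗ c c' m).hom =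
      (αₗ c c' (z ⊙ₗ F.functor.obj m)).hom ≫ c ⊴ₗ (smulIso b F c' m).inv ≫
        (smulIso b F c (c' ⊙ₗ m)).inv := by
  rw [Iso.inv_comp_eq, ← Category.assoc, smulIso_associativity]
  simp only [Category.assoc, ← MonoidalLeftAction.actionHomRight_comp_assoc, Iso.hom_inv_id,
    MonoidalLeftAction.actionHomRight_id, Category.id_comp, Category.comp_id]

theorem smulIso_inv_unitality {z : C} (b : HalfBraiding z) (F : RexModuleFunctor C M N) (m : M) :
    (λₗ (z ⊙ₗ F.functor.obj m)).hom =
      (smulIso b F (𝟙_ C) m).inv ≫ z ⊴ₗ F.functor.map (λₗ m).hom := by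
  rw [Iso.eq_inv_comp, ← cancel_mono (λₗ[C] (z ⊙ₗ F.functor.obj m)).inv, Category.assoc,
    Iso.hom_inv_id, Category.comp_id, smulIso_unitality b F,
    ← MonoidalLeftAction.actionHomRight_comp_assoc, ← Functor.map_comp, Iso.hom_inv_id,
    CategoryTheory.Functor.map_id, MonoidalLeftAction.actionHomRight_id, Category.id_comp]

/-- The functor `m ↦ z . F m`. -/
@[simps]
def smulFunctor (z : C) (F : RexModuleFunctor C M N) : M ⥤ N where
  obj m := z ⊙ₗ F.functor.obj m
  map f := z ⊴ₗ F.functor.map f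

/-- The module functor structure on `m ↦ z . F m`. -/
@[reducible]
def smulLeftLinear {z : C} (b : HalfBraiding z) (F : RexModuleFunctor C M N) :
    (smulFunctor z F).LeftLinear C where
  μₗ c m := (smulIso b F c m).inv
  δₗ c m := (smulIso b F c m).hom
  δₗ_naturality_left := smulIso_naturality_left b F
  δₗ_naturality_right := smulIso_naturality_right b F
  δₗ_associativity := smulIso_associativity b F
  δₗ_unitality_inv := smulIso_unitality b F
  μₗ_naturality_left := smulIso_inv_naturality_left b F
  μₗ_naturality_right := smulIso_inv_naturality_right b F
  μₗ_associativity := smulIso_inv_associativity b F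
  μₗ_unitality := smulIso_inv_unitality b F
  μₗ_comp_δₗ c m := (smulIso b F c m).inv_hom_id
  δₗ_comp_μₗ c m := (smulIso b F c m).hom_inv_id

/-- Isomorphisms of module functors from componentwise isomorphisms. -/
def isoMk {F G : RexModuleFunctor C M N} (e : ∀ m, F.functor.obj m ≅ G.functor.obj m)
    (naturality : ∀ {m m' : M} (g : m ⟶ m'),
      F.functor.map g ≫ (e m').hom = (e m).hom ≫ G.functor.map g)
    (comm : ∀ (c : C) (m : M), (e (c ⊙ₗ m)).hom ≫ G.φ c m = F.φ c m ≫ c ⊴ₗ (e m).hom) :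
    F ≅ G where
  hom := { natTrans := { app m := (e m).hom, naturality _ _ g := naturality g }, comm := comm }
  inv :=
    { natTrans :=
        { app m := (e m).inv
          naturality _ _ g := by
            rw [Iso.eq_inv_comp, ← Category.assoc, Iso.comp_inv_eq, naturality] }
      comm c m := by
        rw [Iso.inv_comp_eq, ← Category.assoc, comm, Category.assoc,
          MonoidalLeftAction.actionHomRight_hom_inv, Category.comp_id] }
  hom_inv_id := hom_ext fun m => (e m).hom_inv_id
  inv_hom_id := hom_ext fun m => (e m).inv_hom_id

variable [RightExactAction C N]

/-- The module functor `z . F`, for `z` an object of the Drinfeld center. -/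
def smul (z : Center C) (F : RexModuleFunctor C M N) : RexModuleFunctor C M N where
  functor := smulFunctor z.1 F
  moduleFunctor := smulLeftLinear z.2 F
  rightExact :=
    have := RightExactAction.actionLeft (M := N) z.1
    inferInstanceAs
      (PreservesFiniteColimits (F.functor ⋙ MonoidalLeftAction.actionLeft N z.1))

/-- The module natural transformation `z . F ⟶ z' . F` given by a morphism `f : z ⟶ z'`. -/
def smulMapLeft {z z' : Center C} (f : z ⟶ z') (F : RexModuleFunctor C M N) :
    smul z F ⟶ smul z' F where
  natTrans :=
    { app m := f.f ⊵ₗ F.functor.obj m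
      naturality _ _ g := MonoidalLeftAction.action_exchange f.f (F.functor.map g) }
  comm c m :=
    calc f.f ⊵ₗ F.functor.obj (c ⊙ₗ m) ≫ z'.1 ⊴ₗ F.φ c m ≫ (swapIso z'.2 c (F.functor.obj m)).hom
      _ = z.1 ⊴ₗ F.φ c m ≫ f.f ⊵ₗ (c ⊙ₗ F.functor.obj m) ≫
          (swapIso z'.2 c (F.functor.obj m)).hom :=
        (MonoidalLeftAction.action_exchange_assoc _ _ _).symm
      _ = z.1 ⊴ₗ F.φ c m ≫ (swapIso z.2 c (F.functor.obj m)).hom ≫ c ⊴ₗ f.f ⊵ₗ F.functor.obj m :=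
        congrArg (fun t => z.1 ⊴ₗ F.φ c m ≫ t) (swapIso_hom_comm f c (F.functor.obj m))
      _ = (z.1 ⊴ₗ F.φ c m ≫ (swapIso z.2 c (F.functor.obj m)).hom) ≫
          c ⊴ₗ f.f ⊵ₗ F.functor.obj m := (Category.assoc _ _ _).symm

/-- The module natural transformation `z . F ⟶ z . G` given by `α : F ⟶ G`. -/
def smulMapRight (z : Center C) {F G : RexModuleFunctor C M N} (α : F ⟶ G) :
    smul z F ⟶ smul z G where
  natTrans :=
    { app m := z.1 ⊴ₗ α.natTrans.app m
      naturality _ _ g := by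
        change z.1 ⊴ₗ F.functor.map g ≫ z.1 ⊴ₗ _ = z.1 ⊴ₗ _ ≫ z.1 ⊴ₗ G.functor.map g
        simp only [← MonoidalLeftAction.actionHomRight_comp, NatTrans.naturality] }
  comm c m :=
    calc z.1 ⊴ₗ α.natTrans.app (c ⊙ₗ m) ≫ z.1 ⊴ₗ G.φ c m ≫ (swapIso z.2 c (G.functor.obj m)).hom
      _ = z.1 ⊴ₗ F.φ c m ≫ z.1 ⊴ₗ c ⊴ₗ α.natTrans.app m ≫
          (swapIso z.2 c (G.functor.obj m)).hom := by
        simp only [← MonoidalLeftAction.actionHomRight_comp_assoc, Hom.comm]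
      _ = z.1 ⊴ₗ F.φ c m ≫ (swapIso z.2 c (F.functor.obj m)).hom ≫
          c ⊴ₗ z.1 ⊴ₗ α.natTrans.app m := by
        rw [swapIso_naturality_right]
      _ = (z.1 ⊴ₗ F.φ c m ≫ (swapIso z.2 c (F.functor.obj m)).hom) ≫
          c ⊴ₗ z.1 ⊴ₗ α.natTrans.app m := (Category.assoc _ _ _).symm

/-- The mixed associator `(z ⊗ z') . F ≅ z . (z' . F)`. -/
noncomputable def smulAssoc (z z' : Center C) (F : RexModuleFunctor C M N) :
    smul (z ⊗ z') F ≅ smul z (smul z' F) :=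
  isoMk (fun m => αₗ z.1 z'.1 (F.functor.obj m))
    (fun g => by
      refine (?_ : (z.1 ⊗ z'.1) ⊴ₗ F.functor.map g ≫ _ = _ ≫ z.1 ⊴ₗ z'.1 ⊴ₗ F.functor.map g)
      simp)
    (fun c m => by
      refine (?_ : (αₗ z.1 z'.1 (F.functor.obj (c ⊙ₗ m))).hom ≫
        z.1 ⊴ₗ (z'.1 ⊴ₗ F.φ c m ≫ (swapIso z'.2 c (F.functor.obj m)).hom) ≫
          (swapIso z.2 c (z'.1 ⊙ₗ F.functor.obj m)).hom =
        ((z.1 ⊗ z'.1) ⊴ₗ F.φ c m ≫ (swapIso (z ⊗ z').2 c (F.functor.obj m)).hom) ≫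
          c ⊴ₗ (αₗ z.1 z'.1 (F.functor.obj m)).hom)
      refine Eq.trans ?_ (Category.assoc _ _ _).symm
      refine Eq.trans ?_ (congrArg (fun t => (z.1 ⊗ z'.1) ⊴ₗ F.φ c m ≫ t)
        (swapIso_tensor z z' c (F.functor.obj m)).symm)
      simp)

/-- The mixed unitor `𝟙 . F ≅ F`. -/
noncomputable def smulUnit (F : RexModuleFunctor C M N) : smul (𝟙_ (Center C)) F ≅ F :=
  isoMk (fun m => λₗ (F.functor.obj m))
    (fun g => (MonoidalLeftAction.actionUnitIso_hom_naturality (F.functor.map g)).symm)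
    (fun c m => by
      refine (?_ : (λₗ (F.functor.obj (c ⊙ₗ m))).hom ≫ F.φ c m = ((𝟙_ C) ⊴ₗ F.φ c m ≫
        (swapIso (𝟙_ (Center C)).2 c (F.functor.obj m)).hom) ≫ c ⊴ₗ (λₗ (F.functor.obj m)).hom)
      refine Eq.trans ?_ (Category.assoc _ _ _).symm
      refine Eq.trans ?_ (congrArg (fun t => (𝟙_ C) ⊴ₗ F.φ c m ≫ t)
        (swapIso_tensorUnit c (F.functor.obj m)).symm)
      exact MonoidalLeftAction.actionUnitIso_hom_naturality _)

/-- The category of right exact `C`-module functors from `M` to `N` is a module category over the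
Drinfeld center of `C`. -/
noncomputable instance : MonoidalLeftAction (Center C) (RexModuleFunctor C M N) where
  actionObj := smul
  actionHomLeft := smulMapLeft
  actionHomRight := smulMapRight
  actionAssocIso := smulAssoc
  actionUnitIso := smulUnit
  actionHom_def _ _ := rfl
  actionHomRight_id z F := hom_ext fun m =>
    MonoidalLeftAction.actionHomRight_id z.1 (F.functor.obj m)
  id_actionHomLeft z F := hom_ext fun m =>
    MonoidalLeftAction.id_actionHomLeft z.1 (F.functor.obj m)
  actionHom_comp {_ _ _ _ _ _} f₁ f₂ α β := hom_ext fun m => by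
    refine (?_ : (f₁.f ≫ f₂.f) ⊵ₗ _ ≫ _ ⊴ₗ (α.natTrans.app m ≫ β.natTrans.app m) =
      (f₁.f ⊵ₗ _ ≫ _ ⊴ₗ α.natTrans.app m) ≫ f₂.f ⊵ₗ _ ≫ _ ⊴ₗ β.natTrans.app m)
    simp only [← MonoidalLeftAction.actionHom_def, MonoidalLeftAction.actionHom_comp]
  actionAssocIso_hom_naturality {_ _ _ _ _ _} f g α := hom_ext fun m => by
    refine (?_ : ((f.f ⊗ₘ g.f) ⊵ₗ _ ≫ _ ⊴ₗ α.natTrans.app m) ≫ _ =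
      _ ≫ f.f ⊵ₗ _ ≫ _ ⊴ₗ (g.f ⊵ₗ _ ≫ _ ⊴ₗ α.natTrans.app m))
    simp only [← MonoidalLeftAction.actionHom_def]
    exact MonoidalLeftAction.actionAssocIso_hom_naturality f.f g.f (α.natTrans.app m)
  actionUnitIso_hom_naturality α := hom_ext fun m =>
    MonoidalLeftAction.actionUnitIso_hom_naturality (α.natTrans.app m)
  whiskerLeft_actionHomLeft z _ _ f F := hom_ext fun m =>
    MonoidalLeftAction.whiskerLeft_actionHomLeft z.1 f.f (F.functor.obj m)
  whiskerRight_actionHomLeft z f F := hom_ext fun m =>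
    MonoidalLeftAction.whiskerRight_actionHomLeft z.1 f.f (F.functor.obj m)
  associator_actionHom z₁ z₂ z₃ F := hom_ext fun m =>
    MonoidalLeftAction.associator_actionHom z₁.1 z₂.1 z₃.1 (F.functor.obj m)
  leftUnitor_actionHom z F := hom_ext fun m =>
    MonoidalLeftAction.leftUnitor_actionHom z.1 (F.functor.obj m)
  rightUnitor_actionHom z F := hom_ext fun m =>
    MonoidalLeftAction.rightUnitor_actionHom z.1 (F.functor.obj m)

end Action

end RexModuleFunctor

/-- An object of internal natural transformations from `G` to `H`: an internal Hom from `G` to `H`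
in the Drinfeld center of `C`, for the category of right exact module functors regarded as a module
category over the Drinfeld center. -/
abbrev InternalNat {C : Type u} [Category.{v} C] [MonoidalCategory C]
    {M : Type u₁} [Category.{v₁} M] [MonoidalLeftAction C M]
    {N : Type u₂} [Category.{v₂} N] [MonoidalLeftAction C N] [RightExactAction C N]
    (G H : RexModuleFunctor C M N) :=
  InternalHom (Center C) G H

end Rex

/-! ### Braided commutativity -/

section Commutative

open RexModuleFunctor

variable {C : Type u} [Category.{v} C] [MonoidalCategory C]
  {M : Type u₁} [Category.{v₁} M] [MonoidalLeftAction C M]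

/-! Commutativity is formal. Write `ev_m : N . m ⟶ m` for the universal module transformation. Its
naturality at the morphism `ev_m` itself says that `N . ev_m` followed by `ev_m` equals `ev_{N . m}`
followed by `ev_m`. Compatibility with the action rewrites `ev_{N . m}` as the half-braiding of `N`
with itself followed by `N . ev_m`. So precomposing with the braiding does not change the
transformation that defines the multiplication (`HalfBraiding.β_action_comp`).

Existence is proved first in `C`, forgetting module structures: one seeks `N` representing `x ↦
Nat(x . -, Id)`. Finiteness of `M` makes these spaces finite-dimensional. Call a family on `x`
separated if it vanishes on no nonzero morphism into `x`. Right exactness of the action lets every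
family factor through a separated one, and a separated family whose object is as large as possible
is universal (`exists_representsIdentity`).

Rigidity then lifts `N` to the center. By duality, `c ⊗ N` and `N ⊗ c` both represent `Nat(x . -, c
. -)`, and the comparison isomorphism is a half-braiding making the universal family a module
transformation (`RepresentsIdentity.exists_halfBraiding`). A morphism in `C` classifying a module
transformation automatically respects half-braidings (`RepresentsIdentity.comm_of_swapIso`), so `N`
has the universal property in the center too. -/

theorem RexModuleFunctor.hom_identity_app_action [RightExactAction C M] {z : Center C}
    (e : z ⊙ₗ identity C M ⟶ identity C M) (c : C) (m : M) :
    e.natTrans.app (c ⊙ₗ m) = (HalfBraiding.swapIso z.2 c m).hom ≫ c ⊴ₗ e.natTrans.app m := by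
  have h : e.natTrans.app (c ⊙ₗ m) ≫ 𝟙 (c ⊙ₗ m) = (z.1 ⊴ₗ 𝟙 (c ⊙ₗ m) ≫
    (HalfBraiding.swapIso z.2 c m).hom) ≫ c ⊴ₗ e.natTrans.app m := e.comm c m
  rw [MonoidalLeftAction.actionHomRight_id, Category.id_comp] at h
  rw [← h]
  exact (Category.comp_id _).symm

/-- In the application `e'` is the component of the same transformation at `z . m`, so `nat` is
naturality at `e` and `he'` is compatibility with the action of `z`. Substituting both on the
right-hand side produces the half-braiding. -/
theorem HalfBraiding.β_action_comp {z : C} (b : HalfBraiding z) {m : M} (e : z ⊙ₗ m ⟶ m)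
    (e' : z ⊙ₗ z ⊙ₗ m ⟶ z ⊙ₗ m) (nat : z ⊴ₗ e ≫ e = e' ≫ e)
    (he' : e' = (swapIso b z m).hom ≫ z ⊴ₗ e) :
    (b.β z).hom ⊵ₗ m ≫ (αₗ z z m).hom ≫ z ⊴ₗ e ≫ e = (αₗ z z m).hom ≫ z ⊴ₗ e ≫ e := by
  conv_rhs => rw [nat, he', swapIso_hom]
  simp only [Category.assoc, Iso.hom_inv_id_assoc]

/-- The internal End of the identity functor is braided commutative. -/
theorem InternalHom.isCommMonObj_identity [RightExactAction C M]
    (A : InternalHom (Center C) (identity C M) (identity C M)) :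
    letI : MonObj A.obj := A.algebra
    IsCommMonObj A.obj := by
  let : MonObj A.obj := A.algebra
  refine ⟨A.hom_ext ?_⟩
  change ((β_ A.obj A.obj).hom ≫ mult A A A) ⊵ₗ _ ≫ A.ev = mult A A A ⊵ₗ _ ≫ A.ev
  rw [MonoidalLeftAction.comp_actionHomLeft, Category.assoc, mult_ev]
  -- The evaluation is natural in particular with respect to its own component at `m`.
  exact RexModuleFunctor.hom_ext fun m => HalfBraiding.β_action_comp A.obj.2 (A.ev.natTrans.app m) _
    (A.ev.natTrans.naturality (A.ev.natTrans.app m)) (hom_identity_app_action A.ev _ m)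

end Commutative

/-! ### Duals acting on a module category -/

section Duals

open MonoidalLeftAction

variable {C : Type u} [Category.{v} C] [MonoidalCategory C]
  {M : Type u₁} [Category.{v₁} M] [MonoidalLeftAction C M]

theorem actionAssocIso_hom_comp_inv (c₁ c₂ c₃ : C) (m : M) :
    (αₗ c₁ c₂ (c₃ ⊙ₗ m)).hom ≫ c₁ ⊴ₗ (αₗ c₂ c₃ m).inv =
      (αₗ (c₁ ⊗ c₂) c₃ m).inv ≫ (α_ c₁ c₂ c₃).hom ⊵ₗ m ≫ (αₗ c₁ (c₂ ⊗ c₃) m).hom := by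
  rw [← cancel_epi (αₗ (c₁ ⊗ c₂) c₃ m).hom, ← associator_actionHom_assoc]
  simp

theorem actionAssocIso_hom_comp_inv' (c₁ c₂ c₃ : C) (m : M) :
    c₁ ⊴ₗ (αₗ c₂ c₃ m).hom ≫ (αₗ c₁ c₂ (c₃ ⊙ₗ m)).inv =
      (αₗ c₁ (c₂ ⊗ c₃) m).inv ≫ (α_ c₁ c₂ c₃).inv ⊵ₗ m ≫ (αₗ (c₁ ⊗ c₂) c₃ m).hom := by
  rw [Iso.comp_inv_eq, Category.assoc, Category.assoc, ← associator_actionHom,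
    inv_hom_actionHomLeft_assoc, Iso.inv_hom_id_assoc]

theorem associator_inv_actionHom (c₁ c₂ c₃ : C) (m : M) :
    (α_ c₁ c₂ c₃).inv ⊵ₗ m ≫ (αₗ (c₁ ⊗ c₂) c₃ m).hom ≫ (αₗ c₁ c₂ (c₃ ⊙ₗ m)).hom =
      (αₗ c₁ (c₂ ⊗ c₃) m).hom ≫ c₁ ⊴ₗ (αₗ c₂ c₃ m).hom := by
  rw [← associator_actionHom, inv_hom_actionHomLeft_assoc]

theorem rightUnitor_inv_actionHom (c : C) (m : M) :
    (ρ_ c).inv ⊵ₗ m ≫ (αₗ c (𝟙_ C) m).hom = c ⊴ₗ (λₗ m).inv := by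
  rw [← cancel_epi ((ρ_ c).hom ⊵ₗ m), hom_inv_actionHomLeft_assoc, rightUnitor_actionHom]
  simp

/-- The counit `d . (c . m) ⟶ m` of the adjunction between the actions of dual objects. -/
def actionCounit (c d : C) [ExactPairing c d] (m : M) : d ⊙ₗ c ⊙ₗ m ⟶ m :=
  (αₗ d c m).inv ≫ ε_ c d ⊵ₗ m ≫ (λₗ m).hom

/-- The unit `m ⟶ c . (d . m)` of the adjunction between the actions of dual objects. -/
def actionUnit (c d : C) [ExactPairing c d] (m : M) : m ⟶ c ⊙ₗ d ⊙ₗ m :=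
  (λₗ m).inv ≫ η_ c d ⊵ₗ m ≫ (αₗ c d m).hom

variable (c d : C) [ExactPairing c d]

theorem actionCounit_naturality {m m' : M} (f : m ⟶ m') :
    d ⊴ₗ c ⊴ₗ f ≫ actionCounit c d m' = actionCounit c d m ≫ f := by
  have h := action_exchange (ε_ c d) f
  rw [tensor_actionHomRight, unit_actionHomRight] at h
  simp only [Category.assoc] at h
  simp only [actionCounit, Category.assoc]
  rw [← cancel_epi (αₗ d c m).hom, ← cancel_mono (λₗ[C] m').inv]
  simpa using h

theorem actionUnit_naturality {m m' : M} (f : m ⟶ m') :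
    f ≫ actionUnit c d m' = actionUnit c d m ≫ c ⊴ₗ d ⊴ₗ f := by
  have h := action_exchange (η_ c d) f
  rw [tensor_actionHomRight, unit_actionHomRight] at h
  simp only [Category.assoc] at h
  simp only [actionUnit, Category.assoc]
  rw [← cancel_epi (λₗ[C] m).hom, ← cancel_mono (αₗ c d m').inv]
  simpa using h

/-- A zigzag identity of the exact pairing, acting on `m`. With `actionCounit_actionUnit` it makes
`d . -` left adjoint to `c . -`. -/
theorem actionUnit_actionCounit (m : M) :
    actionUnit c d (c ⊙ₗ m) ≫ c ⊴ₗ actionCounit c d m = 𝟙 _ := by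
  have h := congrArg (fun t => t ⊵ₗ m) (ExactPairing.evaluation_coevaluation c d)
  simp only [comp_actionHomLeft, whiskerLeft_actionHomLeft, whiskerRight_actionHomLeft,
    leftUnitor_actionHom, Category.assoc, cancel_epi] at h
  have h' := h =≫ (ρ_ c).hom ⊵ₗ m
  simp only [Category.assoc, inv_hom_actionHomLeft, Category.comp_id] at h'
  rw [rightUnitor_actionHom, Iso.inv_hom_id_assoc] at h'
  simp only [actionCounit, actionUnit, actionHomRight_comp, Category.assoc]
  rw [reassoc_of% @actionAssocIso_hom_comp_inv, h', Iso.inv_hom_id]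

theorem actionCounit_actionUnit (m : M) :
    d ⊴ₗ actionUnit c d m ≫ actionCounit c d (d ⊙ₗ m) = 𝟙 _ := by
  have h := congrArg (fun t => t ⊵ₗ m) (ExactPairing.coevaluation_evaluation c d)
  simp only [comp_actionHomLeft, whiskerLeft_actionHomLeft, whiskerRight_actionHomLeft,
    rightUnitor_actionHom, Category.assoc, cancel_epi] at h
  have h' := h =≫ (λ_ d).hom ⊵ₗ m
  simp only [Category.assoc, inv_hom_actionHomLeft, Category.comp_id] at h'
  rw [leftUnitor_actionHom, Iso.inv_hom_id_assoc] at h'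
  simp only [actionCounit, actionUnit, actionHomRight_comp, Category.assoc,
    reassoc_of% @actionAssocIso_hom_comp_inv', h', actionHomRight_inv_hom]

end Duals

/-! ### Objects representing natural transformations out of the action -/

section Represents

open MonoidalLeftAction

variable {C : Type u} [Category.{v} C] [MonoidalCategory C]
  {M : Type u₁} [Category.{v₁} M] [MonoidalLeftAction C M]

/-- The family `e : N . m ⟶ m` is natural and exhibits `N` as a representing object for the
natural transformations from `x . -` to the identity functor, for `x` in `C`. -/
structure RepresentsIdentity (N : C) (e : ∀ m : M, N ⊙ₗ m ⟶ m) : Prop where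
  naturality {m m' : M} (g : m ⟶ m') : N ⊴ₗ g ≫ e m' = e m ≫ g
  existsUnique {x : C} (t : ∀ m : M, x ⊙ₗ m ⟶ m)
    (ht : ∀ {m m' : M} (g : m ⟶ m'), x ⊴ₗ g ≫ t m' = t m ≫ g) :
    ∃! f : x ⟶ N, ∀ m, f ⊵ₗ m ≫ e m = t m

theorem RepresentsIdentity.hom_ext {N : C} {e : ∀ m : M, N ⊙ₗ m ⟶ m}
    (h : RepresentsIdentity N e) {x : C} {f g : x ⟶ N}
    (w : ∀ m, f ⊵ₗ m ≫ e m = g ⊵ₗ m ≫ e m) : f = g :=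
  (h.existsUnique (fun m => g ⊵ₗ m ≫ e m) fun r => by
    rw [Category.assoc, ← h.naturality, action_exchange_assoc]).unique w fun _ => rfl

/-- The family `e : X . m ⟶ c . m` is natural and exhibits `X` as a representing object for the
natural transformations from `x . -` to `c . -`, for `x` in `C`. -/
structure RepresentsAction (c X : C) (e : ∀ m : M, X ⊙ₗ m ⟶ c ⊙ₗ m) : Prop where
  naturality {m m' : M} (g : m ⟶ m') : X ⊴ₗ g ≫ e m' = e m ≫ c ⊴ₗ g
  existsUnique {x : C} (t : ∀ m : M, x ⊙ₗ m ⟶ c ⊙ₗ m)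
    (ht : ∀ {m m' : M} (g : m ⟶ m'), x ⊴ₗ g ≫ t m' = t m ≫ c ⊴ₗ g) :
    ∃! f : x ⟶ X, ∀ m, f ⊵ₗ m ≫ e m = t m

namespace RepresentsAction

variable {c X Y : C} {e : ∀ m : M, X ⊙ₗ m ⟶ c ⊙ₗ m} {e' : ∀ m : M, Y ⊙ₗ m ⟶ c ⊙ₗ m}

theorem hom_ext (h : RepresentsAction c X e) {x : C} {f g : x ⟶ X}
    (w : ∀ m, f ⊵ₗ m ≫ e m = g ⊵ₗ m ≫ e m) : f = g :=
  (h.existsUnique (fun m => g ⊵ₗ m ≫ e m) fun r => by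
    rw [Category.assoc, ← h.naturality, action_exchange_assoc]).unique w fun _ => rfl

/-- Two representing objects are isomorphic. -/
theorem exists_iso (h : RepresentsAction c X e) (h' : RepresentsAction c Y e') :
    ∃ i : X ≅ Y, ∀ m, i.hom ⊵ₗ m ≫ e' m = e m := by
  obtain ⟨f, hf, -⟩ := h'.existsUnique e h.naturality
  obtain ⟨g, hg, -⟩ := h.existsUnique e' h'.naturality
  exact ⟨⟨f, g, h.hom_ext fun m => by simp [hf, hg], h'.hom_ext fun m => by simp [hf, hg]⟩, hf⟩

end RepresentsAction

/-! ### Duality and the half-braiding on the representing object -/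

variable {N : C} {e : ∀ m : M, N ⊙ₗ m ⟶ m}

/-- Since `d . -` is left adjoint to `c . -`, families `x . m ⟶ c . m` transpose to families `(d ⊗
x) . m ⟶ m`, which are morphisms `d ⊗ x ⟶ N`, that is, `x ⟶ c ⊗ N`. -/
theorem RepresentsIdentity.action_left (h : RepresentsIdentity N e) (c d : C) [ExactPairing c d] :
    RepresentsAction c (c ⊗ N) fun m => (αₗ c N m).hom ≫ c ⊴ₗ e m where
  naturality g := by simp [← actionHomRight_comp, h.naturality]
  existsUnique {x} t nat := by
    -- Transposing morphisms in `C` matches transposing the families they induce.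
    have key (f : x ⟶ c ⊗ N) (m : M) : ((tensorLeftHomEquiv x c d N).symm f) ⊵ₗ m ≫ e m =
        (αₗ d x m).hom ≫ d ⊴ₗ (f ⊵ₗ m ≫ (αₗ c N m).hom ≫ c ⊴ₗ e m) ≫ actionCounit c d m := by
      change (d ◁ f ≫ (α_ d c N).inv ≫ ε_ c d ▷ N ≫ (λ_ N).hom) ⊵ₗ m ≫ e m = _
      simp only [actionHomRight_comp, Category.assoc, actionCounit_naturality]
      simp only [actionCounit, Category.assoc, reassoc_of% @actionAssocIso_hom_comp_inv',
        comp_actionHomLeft, whiskerLeft_actionHomLeft, whiskerRight_actionHomLeft,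
        leftUnitor_actionHom, Iso.inv_hom_id_assoc]
    have inj {m : M} {u v : x ⊙ₗ m ⟶ c ⊙ₗ m}
        (w : d ⊴ₗ u ≫ actionCounit c d m = d ⊴ₗ v ≫ actionCounit c d m) : u = v := by
      have h' := congrArg (fun r => actionUnit c d _ ≫ c ⊴ₗ r) w
      simpa only [actionHomRight_comp, ← reassoc_of% @actionUnit_naturality,
        actionUnit_actionCounit, Category.comp_id] using h'
    obtain ⟨s, hs, -⟩ := h.existsUnique (x := d ⊗ x)
      (fun m => (αₗ d x m).hom ≫ d ⊴ₗ t m ≫ actionCounit c d m) fun g => by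
        simp only [tensor_actionHomRight, Category.assoc, Iso.inv_hom_id_assoc,
          ← actionHomRight_comp_assoc, nat]
        rw [actionHomRight_comp_assoc, actionCounit_naturality]
    refine ⟨tensorLeftHomEquiv x c d N s, fun m => inj ?_, fun f hf => ?_⟩
    · have := key (tensorLeftHomEquiv x c d N s) m
      rw [Equiv.symm_apply_apply, hs, cancel_epi] at this
      exact this.symm
    · rw [← Equiv.symm_apply_eq]
      refine h.hom_ext fun m => ?_
      rw [key, hf, hs]

/-- Here `c . -` is left adjoint to `d . -`, and the transposition is by precomposition: evaluating
a family at `d . m` and applying the counit `c . (d . m) ⟶ m` turns `x . - ⟶ c . -` into `(x ⊗ d) .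
- ⟶ Id`. The other duality is needed than in `action_left`. -/
theorem RepresentsIdentity.action_right (h : RepresentsIdentity N e) (c d : C)
    [ExactPairing d c] :
    RepresentsAction c (N ⊗ c) fun m => (αₗ N c m).hom ≫ e (c ⊙ₗ m) where
  naturality g := by simp [h.naturality]
  existsUnique {x} t nat := by
    have key (f : x ⟶ N ⊗ c) (m : M) : ((tensorRightHomEquiv x d c N).symm f) ⊵ₗ m ≫ e m =
        (αₗ x d m).hom ≫ (f ⊵ₗ (d ⊙ₗ m) ≫ (αₗ N c (d ⊙ₗ m)).hom ≫ e (c ⊙ₗ d ⊙ₗ m)) ≫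
          actionCounit d c m := by
      change (f ▷ d ≫ (α_ N c d).hom ≫ N ◁ ε_ d c ≫ (ρ_ N).hom) ⊵ₗ m ≫ e m = _
      simp only [Category.assoc, ← h.naturality]
      simp only [actionCounit, actionHomRight_comp, Category.assoc,
        reassoc_of% @actionAssocIso_hom_comp_inv, comp_actionHomLeft, whiskerLeft_actionHomLeft,
        whiskerRight_actionHomLeft, rightUnitor_actionHom, Iso.inv_hom_id_assoc]
    -- The inverse transposition: insert the unit `m ⟶ d . (c . m)`, then evaluate at `c . m`.
    have key' (g : x ⊗ d ⟶ N) (m : M) :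
        (tensorRightHomEquiv x d c N g) ⊵ₗ m ≫ (αₗ N c m).hom ≫ e (c ⊙ₗ m) =
          x ⊴ₗ actionUnit d c m ≫ (αₗ x d (c ⊙ₗ m)).inv ≫ g ⊵ₗ (c ⊙ₗ m) ≫ e (c ⊙ₗ m) := by
      change ((ρ_ x).inv ≫ x ◁ η_ d c ≫ (α_ x d c).inv ≫ g ▷ c) ⊵ₗ m ≫ _ = _
      simp only [actionUnit, actionHomRight_comp, Category.assoc,
        reassoc_of% @actionAssocIso_hom_comp_inv', comp_actionHomLeft, whiskerLeft_actionHomLeft,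
        whiskerRight_actionHomLeft, Iso.inv_hom_id_assoc, reassoc_of% @rightUnitor_inv_actionHom]
    obtain ⟨s, hs, -⟩ := h.existsUnique (x := x ⊗ d)
      (fun m => (αₗ x d m).hom ≫ t (d ⊙ₗ m) ≫ actionCounit d c m) fun g => by
        simp only [tensor_actionHomRight, Category.assoc, Iso.inv_hom_id_assoc,
          reassoc_of% nat (d ⊴ₗ g), actionCounit_naturality]
    refine ⟨tensorRightHomEquiv x d c N s, fun m => ?_, fun f hf => ?_⟩
    · rw [key', hs, Iso.inv_hom_id_assoc, reassoc_of% nat (actionUnit d c m),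
        actionCounit_actionUnit, Category.comp_id]
    · rw [← Equiv.symm_apply_eq]
      refine h.hom_ext fun m => ?_
      rw [key, hf, hs]

/-- An object that represents the natural transformations to the identity functor has a
half-braiding that is compatible with the universal natural transformation. -/
theorem RepresentsIdentity.exists_halfBraiding [RigidCategory C] (h : RepresentsIdentity N e) :
    ∃ b : HalfBraiding N, ∀ c m, e (c ⊙ₗ m) = (HalfBraiding.swapIso b c m).hom ≫ c ⊴ₗ e m := by
  have left (c : C) := h.action_left c cᘁ
  -- The half-braiding is the unique comparison of two representing objects. Its monoidality and
  -- naturality follow by testing against the universal family of `c ⊗ N`, where `i c` becomes `e`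
  -- evaluated at `c . m`.
  choose i hi using fun c : C => (h.action_right c (ᘁc)).exists_iso (left c)
  refine ⟨⟨i, fun c c' => (left _).hom_ext fun m => ?_, fun {c c'} f =>
    (left _).hom_ext fun m => ?_⟩, fun c m => ?_⟩
  · have hc : c ⊴ₗ (i c').hom ⊵ₗ m ≫ c ⊴ₗ (αₗ c' N m).hom ≫ c ⊴ₗ c' ⊴ₗ e m =
        c ⊴ₗ (αₗ N c' m).hom ≫ c ⊴ₗ e (c' ⊙ₗ m) := by
      simp only [← actionHomRight_comp, hi]
    rw [hi]
    simp only [comp_actionHomLeft, Category.assoc, tensor_actionHomRight,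
      reassoc_of% @associator_inv_actionHom, whiskerLeft_actionHomLeft, Iso.inv_hom_id_assoc,
      reassoc_of% hc, associator_actionHom_assoc, whiskerRight_actionHomLeft,
      reassoc_of% hi c (c' ⊙ₗ m)]
    rw [reassoc_of% h.naturality (αₗ c c' m).hom, Iso.hom_inv_id, Category.comp_id]
  · have hf : (i c).hom ⊵ₗ m ≫ (αₗ c N m).hom ≫ f ⊵ₗ (N ⊙ₗ m) ≫ c' ⊴ₗ e m =
        (αₗ N c m).hom ≫ e (c ⊙ₗ m) ≫ f ⊵ₗ m := by
      rw [← action_exchange, reassoc_of% hi c m]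
    simp only [comp_actionHomLeft, Category.assoc, hi, whiskerLeft_actionHomLeft,
      whiskerRight_actionHomLeft, Iso.inv_hom_id_assoc, hf, h.naturality]
  · simp only [HalfBraiding.swapIso_hom, Category.assoc, hi, Iso.inv_hom_id_assoc]

/-- Both sides land in `c ⊗ N`, so they may be compared after its universal family; there each
becomes the family `t` at `c . m`, by `hb` on one side and `ht` on the other. -/
theorem RepresentsIdentity.comm_of_swapIso [RigidCategory C] (h : RepresentsIdentity N e)
    {b : HalfBraiding N} (hb : ∀ c m, e (c ⊙ₗ m) = (HalfBraiding.swapIso b c m).hom ≫ c ⊴ₗ e m)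
    {z : C} {b' : HalfBraiding z} {f : z ⟶ N} {t : ∀ m : M, z ⊙ₗ m ⟶ m}
    (hf : ∀ m, f ⊵ₗ m ≫ e m = t m)
    (ht : ∀ c m, t (c ⊙ₗ m) = (HalfBraiding.swapIso b' c m).hom ≫ c ⊴ₗ t m) (c : C) :
    f ▷ c ≫ (b.β c).hom = (b'.β c).hom ≫ c ◁ f := by
  refine (h.action_left c cᘁ).hom_ext fun m => ?_
  have h₁ := hf (c ⊙ₗ m)
  rw [hb, ht, HalfBraiding.swapIso_hom, HalfBraiding.swapIso_hom, Category.assoc,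
    Category.assoc, Category.assoc, Category.assoc, ← hf] at h₁
  simp only [comp_actionHomLeft, whiskerLeft_actionHomLeft, whiskerRight_actionHomLeft,
    Category.assoc, h₁, Iso.inv_hom_id_assoc, Iso.hom_inv_id_assoc, actionHomRight_comp]

open RexModuleFunctor in
theorem RepresentsIdentity.nonempty_internalNat [RightExactAction C M] [RigidCategory C]
    (h : RepresentsIdentity N e) : Nonempty (InternalNat (identity C M) (identity C M)) := by
  obtain ⟨b, hb⟩ := h.exists_halfBraiding
  let Nz : Center C := ⟨N, b⟩
  let ev : Nz ⊙ₗ identity C M ⟶ identity C M :=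
    { natTrans := { app := e, naturality _ _ g := h.naturality g }
      comm c m := by
        refine (?_ : e (c ⊙ₗ m) ≫ 𝟙 (c ⊙ₗ m) = (N ⊴ₗ 𝟙 (c ⊙ₗ m) ≫
          (HalfBraiding.swapIso b c m).hom) ≫ c ⊴ₗ e m)
        rw [Category.comp_id, actionHomRight_id, Category.id_comp, hb] }
  -- Injectivity is inherited from `C`; surjectivity also needs the classifying morphism to be
  -- central.
  have bij (z : Center C) : Function.Bijective fun f : z ⟶ Nz => f ⊵ₗ identity C M ≫ ev := by
    refine ⟨fun f g w => Center.ext f g (h.hom_ext fun m => ?_), fun t => ?_⟩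
    · exact congrArg (fun r : z ⊙ₗ identity C M ⟶ identity C M => r.natTrans.app m) w
    · obtain ⟨f, hf, -⟩ := h.existsUnique (x := z.1) t.natTrans.app fun g =>
        t.natTrans.naturality g
      have ht (c : C) (m : M) : t.natTrans.app (c ⊙ₗ m) =
        (HalfBraiding.swapIso z.2 c m).hom ≫ c ⊴ₗ t.natTrans.app m :=
          hom_identity_app_action t c m
      exact ⟨⟨f, h.comm_of_swapIso hb hf ht⟩, RexModuleFunctor.hom_ext fun m => hf m⟩
  exact ⟨⟨Nz, fun z => Equiv.ofBijective _ (bij z), fun f g => by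
    simp only [Equiv.ofBijective_apply, comp_actionHomLeft, Category.assoc]⟩⟩

end Represents

/-! ### Generators of finite linear categories -/

section Generator

variable (k : Type w) [Field k] (X : Type u) [Category.{v} X] [Abelian X] [Linear k X]

open scoped ModuleCat.Algebra in
-- A module map is determined by its values on finitely many generators of `V`, so the Hom space
-- embeds in a finite power of `W`.
theorem FGModuleCat.finite_hom {A : Type w} [Ring A] [Algebra k A] [Module.Finite k A]
    (V W : FGModuleCat.{w} A) : Module.Finite k (V ⟶ W) := by
  obtain ⟨n, s, hs⟩ := Module.Finite.exists_fin (R := A) (M := V)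
  have : Module.Finite k W := Module.Finite.trans A W
  let ψ : (V ⟶ W) →ₗ[k] (Fin n → W) :=
    { toFun f i := f.hom.hom (s i)
      map_add' f g := rfl
      map_smul' r f := rfl }
  refine Module.Finite.of_injective ψ fun f g h => ?_
  refine FGModuleCat.hom_ext (LinearMap.ext_on_range hs fun i => congrFun h i)

theorem FiniteLinearCategory.finite_hom [FiniteLinearCategory k X] (x y : X) :
    Module.Finite k (x ⟶ y) := by
  obtain ⟨A, _, _, _, e, _, _⟩ := FiniteLinearCategory.exists_equivalence (k := k) (X := X)
  have := FGModuleCat.finite_hom k (e.functor.obj x) (e.functor.obj y)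
  exact Module.Finite.of_injective (e.functor.mapLinearMap k) e.functor.map_injective

/-- A finite linear category has an object `G` from which every object receives a finite jointly
epimorphic family of morphisms. -/
theorem FiniteLinearCategory.exists_generator [FiniteLinearCategory k X] :
    ∃ G : X, ∀ x : X, ∃ (n : ℕ) (p : Fin n → (G ⟶ x)),
      ∀ {y : X} (u : x ⟶ y), (∀ i, p i ≫ u = 0) → u = 0 := by
  obtain ⟨A, _, _, _, e, _, _⟩ := FiniteLinearCategory.exists_equivalence (k := k) (X := X)
  -- The generator is the regular module; the morphisms out of it pick out module generators.
  refine ⟨e.inverse.obj (FGModuleCat.of A A), fun x => ?_⟩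
  obtain ⟨n, s, hs⟩ := Module.Finite.exists_fin (R := A) (M := e.functor.obj x)
  let q (i : Fin n) : FGModuleCat.of A A ⟶ e.functor.obj x :=
    FGModuleCat.ofHom (LinearMap.toSpanSingleton A (e.functor.obj x) (s i))
  refine ⟨n, fun i => e.inverse.map (q i) ≫ e.unitInv.app x, fun {y} u hu => ?_⟩
  refine e.functor.map_injective ?_
  rw [Functor.map_zero]
  refine FGModuleCat.hom_ext (LinearMap.ext_on_range hs fun i => ?_)
  have h : q i ≫ e.functor.map u = 0 := by
    refine e.inverse.map_injective ?_
    have := hu i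
    rw [Category.assoc, ← cancel_mono (e.unit.app y)] at this
    simpa using this
  have h' := congrArg (fun r => r.hom.hom (1 : A)) h
  have hq : (q i).hom.hom (1 : A) = s i := LinearMap.toSpanSingleton_apply_one A _ (s i)
  exact (congrArg (e.functor.map u).hom.hom hq).symm.trans h'

end Generator

/-! ### Existence of the representing object -/

section Existence

open MonoidalLeftAction

variable (k : Type w) [Field k]
    {C : Type u} [Category.{v} C] [Abelian C] [Linear k C] [MonoidalCategory C]
    (M : Type u₁) [Category.{v₁} M] [Abelian M] [Linear k M] [MonoidalLeftAction C M]
    [FiniteModuleCategory k C M]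

open FiniteModuleCategory

/-- The space of natural transformations from `x . -` to the identity functor. -/
def natFamilies (x : C) : Submodule k (∀ m : M, x ⊙ₗ m ⟶ m) where
  carrier := {t | ∀ (m m' : M) (g : m ⟶ m'), x ⊴ₗ g ≫ t m' = t m ≫ g}
  add_mem' ha hb m m' g := by simp [ha m m' g, hb m m' g]
  zero_mem' m m' g := by simp
  smul_mem' r t ht m m' g := by simp [ht m m' g]

include k in
theorem FiniteModuleCategory.epi_actionHomRight (x : C) {m m' : M} (g : m ⟶ m') [Epi g] :
    Epi (x ⊴ₗ g) :=
  have := (FiniteModuleCategory.toRightExactAction (k := k) (C := C) (M := M)).actionLeft x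
  inferInstanceAs (Epi ((actionLeft M x).map g))

/-- A natural family is determined by its component at a generator `G` of `M`: every `m` is a
quotient of some `G^n`, and `x . -` preserves epimorphisms. -/
theorem finite_natFamilies (x : C) : Module.Finite k (natFamilies k M x) := by
  obtain ⟨G, hG⟩ := FiniteLinearCategory.exists_generator k M
  have := FiniteLinearCategory.finite_hom k M (x ⊙ₗ G) G
  let ψ : natFamilies k M x →ₗ[k] (x ⊙ₗ G ⟶ G) :=
    (LinearMap.proj (φ := fun m : M => x ⊙ₗ m ⟶ m) G).comp (natFamilies k M x).subtype
  refine Module.Finite.of_injective ψ ((injective_iff_map_eq_zero ψ).2 fun t ht => ?_)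
  have ht : t.1 G = 0 := ht
  refine Subtype.ext (funext fun m => ?_)
  obtain ⟨n, p, hp⟩ := hG m
  have := Abelian.hasFiniteBiproducts (C := M)
  have : Epi (biproduct.desc p) := Preadditive.epi_of_cancel_zero _ fun u hu => hp u fun i => by
    rw [← biproduct.ι_desc p i, Category.assoc, hu, comp_zero]
  have := epi_actionHomRight k M x (biproduct.desc p)
  -- Naturality along the projections `G^n ⟶ G`.
  have h₀ : t.1 (⨁ fun _ : Fin n => G) = 0 := by
    refine biproduct.hom_ext _ _ fun i => ?_
    rw [← t.2, ht, comp_zero, zero_comp]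
  rw [← cancel_epi (x ⊴ₗ biproduct.desc p), t.2, h₀, zero_comp]
  exact comp_zero.symm

/-! ### Cokernels and separated families -/

variable {M}

include k in
theorem FiniteModuleCategory.zero_actionHomLeft (x y : C) (m : M) : (0 : x ⟶ y) ⊵ₗ m = 0 := by
  have := add_actionHomLeft k (0 : x ⟶ y) 0 m
  simpa using this

include k in
theorem FiniteModuleCategory.sub_actionHomLeft {x y : C} (f g : x ⟶ y) (m : M) :
    (f - g) ⊵ₗ m = f ⊵ₗ m - g ⊵ₗ m := by
  rw [eq_sub_iff_add_eq, ← add_actionHomLeft k, sub_add_cancel]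

include k in
/-- The action on an object preserves cokernels. -/
theorem FiniteModuleCategory.cokernel_actionHomLeft {x y : C} (a : y ⟶ x) (m : M) :
    Epi (cokernel.π a ⊵ₗ m) ∧ ∀ {m' : M} (t : x ⊙ₗ m ⟶ m'), a ⊵ₗ m ≫ t = 0 →
      ∃ t', cokernel.π a ⊵ₗ m ≫ t' = t := by
  have := (FiniteModuleCategory.toRightExactAction (k := k) (C := C) (M := M)).actionRight m
  have : (actionRight C m).PreservesZeroMorphisms := ⟨fun x y => zero_actionHomLeft k x y m⟩
  have hc := CokernelCofork.mapIsColimit _ (cokernelIsCokernel a) (actionRight C m)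
  exact ⟨inferInstanceAs (Epi ((actionRight C m).map (cokernel.π a))), fun t ht =>
    ⟨hc.desc (CokernelCofork.ofπ t ht), hc.fac _ WalkingParallelPair.one⟩⟩

theorem natFamilies_cokernel {x y : C} (a : y ⟶ x) {t : ∀ m : M, x ⊙ₗ m ⟶ m}
    (ht : t ∈ natFamilies k M x) (h : ∀ m, a ⊵ₗ m ≫ t m = 0) :
    ∃ t' ∈ natFamilies k M (cokernel a), ∀ m, cokernel.π a ⊵ₗ m ≫ t' m = t m := by
  choose t' ht' using fun m => (cokernel_actionHomLeft k a m).2 (t m) (h m)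
  refine ⟨t', fun m m' g => ?_, ht'⟩
  have := (cokernel_actionHomLeft (M := M) k a m).1
  rw [← cancel_epi (cokernel.π a ⊵ₗ m), ← action_exchange_assoc, ht', ← Category.assoc, ht']
  exact ht m m' g

/-- The space of morphisms `g : y ⟶ x` on which the family `t` of morphisms `x . m ⟶ m` vanishes. -/
def familyAnnihilator {x : C} (t : ∀ m : M, x ⊙ₗ m ⟶ m) (y : C) : Submodule k (y ⟶ x) where
  carrier := {g | ∀ m, g ⊵ₗ m ≫ t m = 0}
  add_mem' ha hb m := by rw [add_actionHomLeft k, Preadditive.add_comp, ha m, hb m, add_zero]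
  zero_mem' m := by rw [zero_actionHomLeft k, zero_comp]
  smul_mem' r a ha m := by rw [smul_actionHomLeft, Linear.smul_comp, ha m, smul_zero]

/-- The family `t` of morphisms `x . m ⟶ m` vanishes on no nonzero morphism to `x`. -/
def IsSeparatedFamily {x : C} (t : ∀ m : M, x ⊙ₗ m ⟶ m) : Prop :=
  ∀ ⦃y : C⦄ (i : y ⟶ x), (∀ m, i ⊵ₗ m ≫ t m = 0) → i = 0

/-- Divide `x` by the images of all morphisms from a generator `G` that `t` kills; finitely many
span them. One quotient suffices, because a killed morphism into the quotient can be pulled back to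
`x` and tested on `G`. -/
theorem natFamilies_exists_separated [FiniteLinearCategory k C] {x : C}
    {t : ∀ m : M, x ⊙ₗ m ⟶ m} (ht : t ∈ natFamilies k M x) :
    ∃ (x' : C) (t' : ∀ m : M, x' ⊙ₗ m ⟶ m) (f : x ⟶ x'), t' ∈ natFamilies k M x' ∧
      IsSeparatedFamily t' ∧ ∀ m, f ⊵ₗ m ≫ t' m = t m := by
  obtain ⟨G, hG⟩ := FiniteLinearCategory.exists_generator k C
  have := FiniteLinearCategory.finite_hom k C G x
  have := Abelian.hasFiniteBiproducts (C := C)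
  let S := familyAnnihilator k t G
  obtain ⟨n, s, hs⟩ := Module.Finite.exists_fin (R := k) (M := S)
  let a : (⨁ fun _ : Fin n => G) ⟶ x := biproduct.desc fun i => (s i).1
  have ha (m : M) : a ⊵ₗ m ≫ t m = 0 := by
    refine (?_ : a ∈ familyAnnihilator k t _) m
    rw [show a = _ from biproduct.desc_eq]
    refine Submodule.sum_mem _ fun i _ m => ?_
    rw [comp_actionHomLeft_assoc, (s i).2, comp_zero]
  obtain ⟨t', ht', hπ⟩ := natFamilies_cokernel k a ht ha
  refine ⟨cokernel a, t', cokernel.π a, ht', fun y j hj => ?_, hπ⟩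
  have hS (g : G ⟶ x) (hg : g ∈ S) : g ≫ cokernel.π a = 0 := by
    have : S ≤ LinearMap.ker (Linear.rightComp k G (cokernel.π a)) := by
      rw [← Submodule.range_subtype S, LinearMap.range_eq_map, ← hs, Submodule.map_span_le]
      rintro _ ⟨i, rfl⟩
      change (s i).1 ≫ cokernel.π a = 0
      rw [← biproduct.ι_desc (fun i => (s i).1) i, Category.assoc, cokernel.condition, comp_zero]
    exact this hg
  -- The pullback of the epimorphism `cokernel.π a` along `j` is again epi, so it is enough that the
  -- other leg, a morphism to `x`, dies in the cokernel.
  rw [← cancel_epi (pullback.fst j (cokernel.π a)), pullback.condition, comp_zero]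
  obtain ⟨n, p, hp⟩ := hG (pullback j (cokernel.π a))
  refine hp _ fun i => ?_
  rw [← Category.assoc]
  refine hS _ fun m => ?_
  rw [← hπ, ← comp_actionHomLeft_assoc, Category.assoc, ← pullback.condition,
    comp_actionHomLeft_assoc, comp_actionHomLeft_assoc, hj, comp_zero, comp_zero]

/-- Separatedness says that pulling `t` back embeds the morphisms `y ⟶ x` in the natural families on
`y`, a bound independent of `x`. -/
theorem finrank_hom_le_of_isSeparatedFamily [FiniteLinearCategory k C] {x : C}
    {t : ∀ m : M, x ⊙ₗ m ⟶ m} (ht : t ∈ natFamilies k M x) (h : IsSeparatedFamily t) (y : C) :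
    Module.finrank k (y ⟶ x) ≤ Module.finrank k (natFamilies k M y) := by
  have := finite_natFamilies k M y
  let ψ : (y ⟶ x) →ₗ[k] natFamilies k M y :=
    { toFun f := ⟨fun m => f ⊵ₗ m ≫ t m, fun m m' g => by
        rw [action_exchange_assoc, Category.assoc, ht]⟩
      map_add' f g := Subtype.ext <| funext fun m => by
        simp [add_actionHomLeft k]
      map_smul' r f := Subtype.ext <| funext fun m => by
        simp [smul_actionHomLeft] }
  refine LinearMap.finrank_le_finrank_of_injective (f := ψ)
    ((injective_iff_map_eq_zero ψ).2 fun f hf => h f fun m => ?_)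
  exact congrFun (congrArg Subtype.val hf) m

-- Size is measured by the dimension of `Hom(G, x)`, which is bounded over all separated families. A
-- family attaining the maximum absorbs every other one.
variable (C M) in
theorem exists_representsIdentity [FiniteLinearCategory k C] :
    ∃ (N : C) (e : ∀ m : M, N ⊙ₗ m ⟶ m), RepresentsIdentity N e := by
  obtain ⟨G, hG⟩ := FiniteLinearCategory.exists_generator k C
  have hsep {x y : C} (u : x ⟶ y) (hu : ∀ g : G ⟶ x, g ≫ u = 0) : u = 0 := by
    obtain ⟨n, p, hp⟩ := hG x
    exact hp u fun i => hu _
  let D : Set ℕ := {d | ∃ (x : C) (t : ∀ m : M, x ⊙ₗ m ⟶ m), t ∈ natFamilies k M x ∧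
    IsSeparatedFamily t ∧ Module.finrank k (G ⟶ x) = d}
  have hD : D.Nonempty := by
    obtain ⟨x, t, -, ht, ht', -⟩ :=
      natFamilies_exists_separated k (natFamilies k M G).zero_mem
    exact ⟨_, x, t, ht, ht', rfl⟩
  have hD' : BddAbove D := ⟨Module.finrank k (natFamilies k M G), by
    rintro _ ⟨x, t, ht, ht', rfl⟩
    exact finrank_hom_le_of_isSeparatedFamily k ht ht' G⟩
  obtain ⟨N, e, he, hsepN, hN⟩ := Nat.sSup_mem hD hD'
  refine ⟨N, e, fun g => he _ _ g, fun {x} t ht => ?_⟩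
  have ht : t ∈ natFamilies k M x := fun _ _ g => ht g
  obtain ⟨f, hf⟩ : ∃ f : x ⟶ N, ∀ m, f ⊵ₗ m ≫ e m = t m := by
    -- Combine `e` and `t` into one family on `N ⊞ x` and pass to a separated family on `y`. By
    -- maximality `N ⟶ y` will be an isomorphism, and `x ⟶ y ≅ N` is the factorization.
    have hs : (fun m => (biprod.fst : N ⊞ x ⟶ N) ⊵ₗ m ≫ e m + biprod.snd ⊵ₗ m ≫ t m) ∈
        natFamilies k M (N ⊞ x) := fun m m' g => by
      rw [Preadditive.comp_add, Preadditive.add_comp, action_exchange_assoc,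
        action_exchange_assoc, he, ht, Category.assoc, Category.assoc]
    obtain ⟨y, r, p, hr, hr', hp⟩ := natFamilies_exists_separated k hs
    have hl (m : M) : (biprod.inl ≫ p) ⊵ₗ m ≫ r m = e m := by
      rw [comp_actionHomLeft_assoc, hp, Preadditive.comp_add, ← comp_actionHomLeft_assoc,
        ← comp_actionHomLeft_assoc, biprod.inl_fst, biprod.inl_snd, zero_actionHomLeft k]
      simp
    have hr'' (m : M) : (biprod.inr ≫ p) ⊵ₗ m ≫ r m = t m := by
      rw [comp_actionHomLeft_assoc, hp, Preadditive.comp_add, ← comp_actionHomLeft_assoc,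
        ← comp_actionHomLeft_assoc, biprod.inr_fst, biprod.inr_snd, zero_actionHomLeft k]
      simp
    have : Mono (biprod.inl ≫ p) := Preadditive.mono_of_cancel_zero _ fun g hg =>
      hsepN g fun m => by
        rw [← hl, ← comp_actionHomLeft_assoc, hg, zero_actionHomLeft k, zero_comp]
    have := FiniteLinearCategory.finite_hom k C G N
    have := FiniteLinearCategory.finite_hom k C G y
    have hinj : Function.Injective (Linear.rightComp k G (biprod.inl ≫ p)) := fun g g' hg =>
      (cancel_mono (biprod.inl ≫ p)).1 hg
    have hle : Module.finrank k (G ⟶ y) ≤ Module.finrank k (G ⟶ N) :=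
      hN ▸ le_csSup hD' ⟨y, r, hr, hr', rfl⟩
    -- Maximality forces equal dimensions, so every morphism `G ⟶ y` factors through `N`; as `G`
    -- generates, `N ⟶ y` is epi.
    have hsurj := (LinearMap.injective_iff_surjective_of_finrank_eq_finrank
      ((LinearMap.finrank_le_finrank_of_injective hinj).antisymm hle)).1 hinj
    have : Epi (biprod.inl ≫ p) := Preadditive.epi_of_cancel_zero _ fun u hu => hsep u fun g => by
      obtain ⟨g', rfl⟩ := hsurj g
      change (g' ≫ biprod.inl ≫ p) ≫ u = 0
      rw [Category.assoc, hu, comp_zero]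
    have := isIso_of_mono_of_epi (biprod.inl ≫ p)
    refine ⟨(biprod.inr ≫ p) ≫ inv (biprod.inl ≫ p), fun m => ?_⟩
    rw [← hr'', comp_actionHomLeft_assoc, ← hl, ← comp_actionHomLeft_assoc (inv _),
      IsIso.inv_hom_id, id_actionHomLeft, Category.id_comp]
  refine ⟨f, hf, fun g hg => sub_eq_zero.1 (hsepN _ fun m => ?_)⟩
  rw [sub_actionHomLeft k, Preadditive.sub_comp, hf, hg, sub_self]

end Existence

theorem mainTheorem6
    (k : Type w) [Field k] [IsAlgClosed k]
    (C : Type u) [Category.{v} C] [Abelian C] [Linear k C] [MonoidalCategory C]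
    [FiniteTensorCategory k C]
    (M : Type u₁) [Category.{v₁} M] [Abelian M] [Linear k M] [MonoidalLeftAction C M]
    [FiniteModuleCategory k C M] :
    Nonempty (InternalNat (RexModuleFunctor.identity C M) (RexModuleFunctor.identity C M)) ∧
    ∀ A : InternalNat (RexModuleFunctor.identity C M) (RexModuleFunctor.identity C M),
      letI : MonObj A.obj := A.algebra
      IsCommMonObj A.obj := by
  obtain ⟨_⟩ := FiniteTensorCategory.rigid (k := k) (C := C)
  obtain ⟨N, e, h⟩ := exists_representsIdentity k C M
  exact ⟨h.nonempty_internalNat, InternalHom.isCommMonObj_identity⟩
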